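/- For every $c>0$ there is a constant $p>0$, depending only on $c$, such that the following holds. Let $d\ge 1$, $\mu,L>0$, $\epsilon\in(0,1)$, and let $f:\mathbb R^d\to\mathbb R$ be a differentiable function with $$\mu\le\frac{f(y)-f(x)-\langle\nabla f(x),y-x\rangle}{\|x-y\|^2/2}\le L\qquad\text{for all }x\ne y$$ (that is, $f$ is $\mu$-strongly convex and $L$-smooth), attaining its minimum at the origin. Let $M\ge1$ and let $\sigma_1,\dots,\sigma_M$ satisfy $$\sigma_1^2=\frac{\epsilon}{2dL},\qquad \sigma_{i+1}^2=\Bigl(1+\frac1{\sqrt d}\Bigr)\sigma_i^2\ (1\le i<M),\qquad \sigma_M^2\ge c\,\frac{\sqrt d}{\mu}.$$ Let $f_0(x)=\frac{\|x\|^2}{2\sigma_1^2}$, let $f_i(x)=f(x)+\frac{\|x\|^2}{2\sigma_i^2}$ for $1\le i\le M$, and let $f_{M+1}=f$. Let $\pi_0(x)=(2\pi\sigma_1^2)^{-d/2}e^{-f_0(x)}$ be the Gaussian density and, for $1\le i\le M+1$, let $\pi_i(x)=Z_i^{-1}e^{-f_i(x)}$ with $Z_i=\int_{\mathbb R^d}e^{-f_i(x)}\,dx$.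 Let $|\pi_i\rangle=\int_{\mathbb R^d}\sqrt{\pi_i(x)}\,|x\rangle\,dx$ be the qsample state, i.e. the vector $\sqrt{\pi_i}$ of $L^2(\mathbb R^d;\mathbb C)$. Then $$|\langle\pi_i|\pi_{i+1}\rangle|\ge p\qquad\text{for all }0\le i\le M.$$ -/

import Mathlib

open MeasureTheory

noncomputable section

/-- `f` is differentiable and, for all `x ≠ y`,
`(f y - f x - ⟪∇f x, y - x⟫) / (‖x - y‖² / 2) ∈ [μ, L]`, i.e. `f` is `L`-smooth and
`μ`-strongly convex. -/
def IsSmoothStronglyConvex {d : ℕ} (μ L : ℝ) (f : EuclideanSpace ℝ (Fin d) → ℝ) : Prop :=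
  Differentiable ℝ f ∧
    ∀ x y : EuclideanSpace ℝ (Fin d), x ≠ y →
      (f y - f x - inner ℝ (gradient f x) (y - x)) / (‖x - y‖ ^ 2 / 2) ∈ Set.Icc μ L

/-- The potentials `f₀ = ‖x‖²/(2σ₁²)`, `f_i = f + ‖x‖²/(2σ_i²)` for `1 ≤ i ≤ M`, and
`f_i = f` for `i > M` (only `i = M + 1` is used). -/
def annealPotential {d : ℕ} (f : EuclideanSpace ℝ (Fin d) → ℝ) (σ : ℕ → ℝ) (M i : ℕ)
    (x : EuclideanSpace ℝ (Fin d)) : ℝ :=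
  if i = 0 then ‖x‖ ^ 2 / (2 * σ 1 ^ 2)
  else if i ≤ M then f x + ‖x‖ ^ 2 / (2 * σ i ^ 2)
  else f x

/-- The densities with respect to Lebesgue measure: the Gaussian density
`π₀ = (2πσ₁²)^(-d/2) exp(-f₀)`, and `π_i = Z_i⁻¹ exp(-f_i)` with `Z_i = ∫ exp(-f_i)`
for `i ≥ 1`. -/
def annealDensity {d : ℕ} (f : EuclideanSpace ℝ (Fin d) → ℝ) (σ : ℕ → ℝ) (M i : ℕ)
    (x : EuclideanSpace ℝ (Fin d)) : ℝ :=
  if i = 0 then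
    (2 * Real.pi * σ 1 ^ 2) ^ (-(d : ℝ) / 2) * Real.exp (-annealPotential f σ M 0 x)
  else
    (∫ y, Real.exp (-annealPotential f σ M i y))⁻¹ * Real.exp (-annealPotential f σ M i x)

open Classical in
/-- The qsample state `∫ √(ρ x) |x⟩ dx` of a density `ρ` on `ℝᵈ`: the element of
`L²(ℝᵈ; ℂ)` given by the function `√ρ`. (If `√ρ` is not square integrable, the value is `0`,
whose overlap with every state is `0`.) -/
def qsample {d : ℕ} (ρ : EuclideanSpace ℝ (Fin d) → ℝ) :
    Lp ℂ 2 (volume : Measure (EuclideanSpace ℝ (Fin d))) :=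
  if h : MemLp (fun x => ((Real.sqrt (ρ x) : ℝ) : ℂ)) 2 volume then h.toLp _ else 0

end

/-!
For Gibbs densities of potentials `u` and `v`, the overlap of the qsample states is
`Z((u + v) / 2) / √(Z(u) Z(v))`, where `Z` denotes the partition function. If `f` is `μ`-strongly
convex with minimum at the origin, then `g = f - μ‖·‖² / 2` is convex with minimum at the origin,
and `f + a‖·‖² / 2` is `g` confined with strength `a + μ`. For strengths `s` and `t` the
Prékopa–Leindler inequality is applied with weights `1 / 2`, not at the midpoint of `x` and `y` but
at its contraction by `r = √(s t) / ((s + t) / 2)`: this is the largest factor for which the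
quadratic parts compare, and contracting only decreases the convex part. The contraction costs a
Jacobian `r ^ d`, so the overlap is at least `r ^ d ≥ exp (-d (s - t)² / (8 s t))`, which is bounded
below because the strength changes by a relative amount `O(1 / √d)` in each step, the last one
included. In the first step `f` lies between `f 0` and `f 0 + L‖·‖² / 2`, and all partition
functions are compared with those of Gaussians.
-/

open scoped ENNReal Pointwise

section PrekopaLeindler

theorem volume_add_volume_le_volume_add_of_isCompact {A B : Set ℝ} (hA : IsCompact A)
    (hB : IsCompact B) (hAne : A.Nonempty) (hBne : B.Nonempty) :
    volume A + volume B ≤ volume (A + B) := by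
  obtain ⟨a, haA, ha⟩ := hA.exists_isGreatest hAne
  obtain ⟨b, hbB, hb⟩ := hB.exists_isLeast hBne
  -- The translates `b + A` and `a + B` lie in `A + B` and meet only at the point `a + b`.
  have hdisj : AEDisjoint volume (b +ᵥ A) (a +ᵥ B) := by
    refine measure_mono_null (t := {a + b}) ?_ (by simp)
    rintro - ⟨⟨x, hx, rfl⟩, ⟨y, hy, hxy⟩⟩
    have hxa := ha hx
    have hby := hb hy
    simp only [vadd_eq_add, Set.mem_singleton_iff] at hxy ⊢
    linarith
  calc volume A + volume B = volume ((b +ᵥ A) ∪ (a +ᵥ B)) := by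
        rw [measure_union₀ (hB.measurableSet.const_vadd a).nullMeasurableSet hdisj,
          measure_vadd, measure_vadd]
    _ ≤ volume (A + B) := by
        refine measure_mono (Set.union_subset ?_ (Set.vadd_set_subset_add haA))
        rw [add_comm A B]
        exact Set.vadd_set_subset_add hbB

theorem volume_add_volume_le_volume_add {A B : Set ℝ} (hA : MeasurableSet A)
    (hB : MeasurableSet B) (hA' : A.Nonempty) (hB' : B.Nonempty) :
    volume A + volume B ≤ volume (A + B) := by
  obtain ⟨a, ha⟩ := hA'
  obtain ⟨b, hb⟩ := hB'
  rw [hA.measure_eq_iSup_isCompact, hB.measure_eq_iSup_isCompact]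
  simp_rw [iSup_and']
  refine ENNReal.biSup_add_biSup_le' ⟨∅, by simp⟩ ⟨∅, by simp⟩ ?_
  rintro K ⟨hKA, hK⟩ L ⟨hLB, hL⟩
  calc volume K + volume L ≤ volume (insert a K) + volume (insert b L) := by
        gcongr <;> exact Set.subset_insert _ _
    _ ≤ volume (insert a K + insert b L) :=
        volume_add_volume_le_volume_add_of_isCompact (hK.insert a) (hL.insert b)
          (Set.insert_nonempty _ _) (Set.insert_nonempty _ _)
    _ ≤ volume (A + B) :=
        measure_mono (Set.add_subset_add (Set.insert_subset ha hKA) (Set.insert_subset hb hLB))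

theorem lintegral_eq_lintegral_meas_ofReal_lt {α : Type*} [MeasurableSpace α] (μ : Measure α)
    [SFinite μ] {F : α → ℝ≥0∞} (hF : Measurable F) :
    ∫⁻ x, F x ∂μ = ∫⁻ τ in Set.Ioi (0 : ℝ), μ {x | ENNReal.ofReal τ < F x} := by
  have hS : MeasurableSet {p : α × ℝ | ENNReal.ofReal p.2 < F p.1} :=
    measurableSet_lt (by fun_prop) (by fun_prop)
  have hsection (c : ℝ≥0∞) :
      volume.restrict (Set.Ioi (0 : ℝ)) {τ | ENNReal.ofReal τ < c} = c := by
    rw [Measure.restrict_apply (measurableSet_lt (by fun_prop) (by fun_prop))]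
    induction c with
    | top => simp
    | coe c =>
      have : {τ : ℝ | ENNReal.ofReal τ < c} ∩ Set.Ioi 0 = Set.Ioo 0 (c : ℝ) := by
        ext τ
        exact (and_congr_left fun hτ => ENNReal.ofReal_lt_coe_iff (le_of_lt hτ)).trans and_comm
      simp [this]
  calc ∫⁻ x, F x ∂μ
      = (μ.prod (volume.restrict (Set.Ioi (0 : ℝ)))) {p | ENNReal.ofReal p.2 < F p.1} := by
        rw [Measure.prod_apply hS]
        exact lintegral_congr fun x => (hsection (F x)).symm
    _ = _ := Measure.prod_apply_symm hS

theorem ennreal_geom_mean_le_arith_mean {s t : ℝ} (hs : 0 < s) (ht : 0 < t) (hst : s + t = 1)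
    (x y : ℝ≥0∞) : x ^ s * y ^ t ≤ ENNReal.ofReal s * x + ENNReal.ofReal t * y := by
  have hpq : s⁻¹.HolderConjugate t⁻¹ := by
    rw [Real.holderConjugate_iff]
    refine ⟨(one_lt_inv₀ hs).2 (by linarith), by simpa using hst⟩
  have := ENNReal.young_inequality (x ^ s) (y ^ t) hpq
  rwa [ENNReal.rpow_rpow_inv hs.ne', ENNReal.rpow_rpow_inv ht.ne', ENNReal.ofReal_inv_of_pos hs,
    ENNReal.ofReal_inv_of_pos ht, div_eq_mul_inv, div_eq_mul_inv, inv_inv, inv_inv,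
    mul_comm x, mul_comm y] at this

section Real

variable {s t : ℝ} {F G H : ℝ → ℝ≥0∞}

/- Level by level, this is the one-dimensional Brunn–Minkowski inequality; the suprema are
normalized so that the level sets of `F` and `G` become empty at the same height. -/
theorem add_lintegral_le_lintegral_of_iSup_eq_one (hs : 0 < s) (ht : 0 < t) (hst : s + t = 1)
    (hF : Measurable F) (hG : Measurable G) (hH : Measurable H)
    (hF1 : ⨆ x, F x = 1) (hG1 : ⨆ x, G x = 1)
    (h : ∀ x y, F x ^ s * G y ^ t ≤ H (s • x + t • y)) :
    ENNReal.ofReal s * (∫⁻ x, F x) + ENNReal.ofReal t * ∫⁻ x, G x ≤ ∫⁻ x, H x := by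
  simp only [lintegral_eq_lintegral_meas_ofReal_lt volume hF,
    lintegral_eq_lintegral_meas_ofReal_lt volume hG,
    lintegral_eq_lintegral_meas_ofReal_lt volume hH]
  have hanti (u : ℝ → ℝ≥0∞) : Measurable fun τ : ℝ => volume {x | ENNReal.ofReal τ < u x} :=
    Antitone.measurable fun τ τ' hτ =>
      measure_mono fun x hx => (ENNReal.ofReal_le_ofReal hτ).trans_lt hx
  rw [← lintegral_const_mul _ (hanti F), ← lintegral_const_mul _ (hanti G),
    ← lintegral_add_left ((hanti F).const_mul _)]
  refine lintegral_mono fun τ => ?_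
  rcases le_or_gt 1 (ENNReal.ofReal τ) with hτ | hτ
  · have hempty {u : ℝ → ℝ≥0∞} (hu : ⨆ x, u x = 1) : {x | ENNReal.ofReal τ < u x} = ∅ :=
      Set.eq_empty_of_forall_notMem fun x => ((le_iSup u x).trans (hu.le.trans hτ)).not_gt
    simp [hempty hF1, hempty hG1]
  · have hlevel : s • {x | ENNReal.ofReal τ < F x} + t • {x | ENNReal.ofReal τ < G x} ⊆
        {x | ENNReal.ofReal τ < H x} := by
      rintro - ⟨-, ⟨x, hx, rfl⟩, -, ⟨y, hy, rfl⟩, rfl⟩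
      calc ENNReal.ofReal τ = ENNReal.ofReal τ ^ s * ENNReal.ofReal τ ^ t := by
            rw [← ENNReal.rpow_add_of_nonneg _ _ hs.le ht.le, hst, ENNReal.rpow_one]
        _ < F x ^ s * G y ^ t :=
            ENNReal.mul_lt_mul (ENNReal.rpow_lt_rpow hx hs) (ENNReal.rpow_lt_rpow hy ht)
        _ ≤ H (s • x + t • y) := h x y
    have hne {u : ℝ → ℝ≥0∞} (hu : ⨆ x, u x = 1) : {x | ENNReal.ofReal τ < u x}.Nonempty :=
      lt_iSup_iff.1 (hτ.trans_eq hu.symm)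
    have hsmul {r : ℝ} (hr : 0 < r) (A : Set ℝ) :
        volume (r • A) = ENNReal.ofReal r * volume A := by
      simp [Measure.addHaar_smul, abs_of_pos hr]
    have hmeas {u : ℝ → ℝ≥0∞} (hu : Measurable u) : MeasurableSet {x | ENNReal.ofReal τ < u x} :=
      measurableSet_lt measurable_const hu
    rw [← hsmul hs, ← hsmul ht]
    exact (volume_add_volume_le_volume_add ((hmeas hF).const_smul₀ s) ((hmeas hG).const_smul₀ t)
      (hne hF1).smul_set (hne hG1).smul_set).trans (measure_mono hlevel)

theorem rpow_lintegral_mul_le_lintegral_of_iSup_ne_top (hs : 0 < s) (ht : 0 < t)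
    (hst : s + t = 1) (hF : Measurable F) (hG : Measurable G) (hH : Measurable H)
    (hFtop : ⨆ x, F x ≠ ⊤) (hGtop : ⨆ x, G x ≠ ⊤)
    (h : ∀ x y, F x ^ s * G y ^ t ≤ H (s • x + t • y)) :
    (∫⁻ x, F x) ^ s * (∫⁻ x, G x) ^ t ≤ ∫⁻ x, H x := by
  set α := ⨆ x, F x with hα
  set β := ⨆ x, G x with hβ
  rcases eq_or_ne α 0 with hα0 | hα0
  · simp [ENNReal.iSup_eq_zero.1 (hα.symm.trans hα0), hs]
  rcases eq_or_ne β 0 with hβ0 | hβ0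
  · simp [ENNReal.iSup_eq_zero.1 (hβ.symm.trans hβ0), ht]
  set γ : ℝ≥0∞ := (α⁻¹) ^ s * (β⁻¹) ^ t with hγ
  have hγ0 : γ ≠ 0 := by simp [hγ, hFtop, hGtop, hs.not_gt, ht.not_gt]
  have hγtop : γ ≠ ⊤ := ENNReal.mul_ne_top
    (ENNReal.rpow_ne_top_of_nonneg hs.le (ENNReal.inv_ne_top.2 hα0))
    (ENNReal.rpow_ne_top_of_nonneg ht.le (ENNReal.inv_ne_top.2 hβ0))
  have hscale (x y : ℝ≥0∞) : (α⁻¹ * x) ^ s * (β⁻¹ * y) ^ t = γ * (x ^ s * y ^ t) := by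
    rw [ENNReal.mul_rpow_of_nonneg _ _ hs.le, ENNReal.mul_rpow_of_nonneg _ _ ht.le,
      mul_mul_mul_comm]
  refine (ENNReal.mul_le_mul_iff_right hγ0 hγtop).1 ?_
  calc γ * ((∫⁻ x, F x) ^ s * (∫⁻ x, G x) ^ t)
      = (∫⁻ x, α⁻¹ * F x) ^ s * (∫⁻ x, β⁻¹ * G x) ^ t := by
        rw [lintegral_const_mul _ hF, lintegral_const_mul _ hG, hscale]
    _ ≤ ENNReal.ofReal s * (∫⁻ x, α⁻¹ * F x) + ENNReal.ofReal t * ∫⁻ x, β⁻¹ * G x :=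
        ennreal_geom_mean_le_arith_mean hs ht hst _ _
    _ ≤ ∫⁻ x, γ * H x := by
        refine add_lintegral_le_lintegral_of_iSup_eq_one hs ht hst (hF.const_mul _)
          (hG.const_mul _) (hH.const_mul _) ?_ ?_ fun x y => ?_
        · rw [← ENNReal.mul_iSup, ENNReal.inv_mul_cancel hα0 hFtop]
        · rw [← ENNReal.mul_iSup, ENNReal.inv_mul_cancel hβ0 hGtop]
        · rw [hscale]
          exact mul_le_mul_right (h x y) γ
    _ = γ * ∫⁻ x, H x := lintegral_const_mul _ hH

end Real

theorem rpow_lintegral_eq_iSup_rpow_lintegral_min {α : Type*} [MeasurableSpace α] {μ : Measure α}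
    {F : α → ℝ≥0∞} (hF : Measurable F) {s : ℝ} (hs : 0 < s) :
    (∫⁻ x, F x ∂μ) ^ s = ⨆ n : ℕ, (∫⁻ x, min (F x) n ∂μ) ^ s := by
  have htrunc : ∫⁻ x, F x ∂μ = ⨆ n : ℕ, ∫⁻ x, min (F x) n ∂μ := by
    rw [← lintegral_iSup (fun n => hF.min measurable_const) fun m n hmn x => by dsimp only; gcongr]
    refine lintegral_congr fun x => ?_
    rw [← inf_iSup_eq, ENNReal.iSup_natCast, inf_top_eq]
  rw [htrunc]
  exact (ENNReal.orderIsoRpow s hs).map_iSup _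

/-- The Prékopa–Leindler inequality for the measure `μ`, quantified over all pairs of weights
`s + t = 1`. It is a predicate so that the inequality can be transported from the real line to
products and along measure-preserving linear maps. -/
def PrekopaLeindler {E : Type*} [AddCommGroup E] [Module ℝ E] [MeasurableSpace E]
    (μ : Measure E) : Prop :=
  ∀ ⦃s t : ℝ⦄, 0 < s → 0 < t → s + t = 1 → ∀ ⦃F G H : E → ℝ≥0∞⦄, Measurable F → Measurable G →
    Measurable H → (∀ x y, F x ^ s * G y ^ t ≤ H (s • x + t • y)) →
      (∫⁻ x, F x ∂μ) ^ s * (∫⁻ x, G x ∂μ) ^ t ≤ ∫⁻ x, H x ∂μ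

theorem prekopaLeindler_real : PrekopaLeindler (volume : Measure ℝ) := by
  intro s t hs ht hst F G H hF hG hH h
  rw [rpow_lintegral_eq_iSup_rpow_lintegral_min hF hs,
    rpow_lintegral_eq_iSup_rpow_lintegral_min hG ht]
  simp only [ENNReal.iSup_mul, ENNReal.mul_iSup]
  refine iSup₂_le fun n m => ?_
  have hbdd (u : ℝ → ℝ≥0∞) (k : ℕ) : ⨆ x, min (u x) k ≠ ⊤ :=
    ne_top_of_le_ne_top (ENNReal.natCast_ne_top k) (iSup_le fun x => min_le_right _ _)
  refine rpow_lintegral_mul_le_lintegral_of_iSup_ne_top hs ht hst (hF.min measurable_const)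
    (hG.min measurable_const) hH (hbdd F m) (hbdd G n) fun x y => le_trans ?_ (h x y)
  gcongr <;> exact min_le_left _ _

namespace PrekopaLeindler

variable {E E' : Type*} [AddCommGroup E] [Module ℝ E] [MeasurableSpace E] {μ : Measure E}
  [AddCommGroup E'] [Module ℝ E'] [MeasurableSpace E'] {ν : Measure E'}

theorem prod [SFinite ν] (hμ : PrekopaLeindler μ) (hν : PrekopaLeindler ν) :
    PrekopaLeindler (μ.prod ν) := by
  intro s t hs ht hst F G H hF hG hH h
  rw [lintegral_prod _ hF.aemeasurable, lintegral_prod _ hG.aemeasurable,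
    lintegral_prod _ hH.aemeasurable]
  exact hμ hs ht hst hF.lintegral_prod_right' hG.lintegral_prod_right' hH.lintegral_prod_right'
    fun x y => hν hs ht hst (by fun_prop) (by fun_prop) (by fun_prop) fun u v => h (x, u) (y, v)

theorem of_measurePreserving (hμ : PrekopaLeindler μ) {T : E → E'} (hT : MeasurePreserving T μ ν)
    (hlin : IsLinearMap ℝ T) : PrekopaLeindler ν := by
  intro s t hs ht hst F G H hF hG hH h
  rw [← hT.lintegral_comp hF, ← hT.lintegral_comp hG, ← hT.lintegral_comp hH]
  refine hμ hs ht hst (hF.comp hT.measurable) (hG.comp hT.measurable) (hH.comp hT.measurable)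
    fun x y => ?_
  rw [hlin.map_add, hlin.map_smul, hlin.map_smul]
  exact h (T x) (T y)

end PrekopaLeindler

theorem prekopaLeindler_pi (n : ℕ) : PrekopaLeindler (volume : Measure (Fin n → ℝ)) := by
  induction n with
  | zero =>
    intro s t _ _ _ F G H _ _ _ h
    simp only [volume_pi, Measure.pi_of_empty _ (default : Fin 0 → ℝ), lintegral_dirac]
    exact (h _ _).trans_eq (congrArg H (Subsingleton.elim _ _))
  | succ n ih =>
    refine (prekopaLeindler_real.prod ih).of_measurePreserving
      (volume_preserving_piFinSuccAbove (fun _ => ℝ) 0).symm ⟨fun x y => ?_, fun c x => ?_⟩ <;>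
    · ext i
      refine Fin.cases ?_ (fun j => ?_) i <;> simp [MeasurableEquiv.piFinSuccAbove]

theorem prekopaLeindler_volume (E : Type*) [NormedAddCommGroup E] [InnerProductSpace ℝ E]
    [FiniteDimensional ℝ E] [MeasurableSpace E] [BorelSpace E] :
    PrekopaLeindler (volume : Measure E) :=
  ((prekopaLeindler_pi _).of_measurePreserving (PiLp.volume_preserving_toLp _)
    (WithLp.linearEquiv 2 ℝ _).symm.isLinear).of_measurePreserving
      (stdOrthonormalBasis ℝ E).measurePreserving_repr_symm
      (stdOrthonormalBasis ℝ E).repr.symm.toLinearEquiv.isLinear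

theorem PrekopaLeindler.rpow_integral_exp_neg_mul_le {E : Type*} [AddCommGroup E] [Module ℝ E]
    [MeasurableSpace E] {μ : Measure E} (hμ : PrekopaLeindler μ) {s t : ℝ} (hs : 0 < s)
    (ht : 0 < t) (hst : s + t = 1) {u v w : E → ℝ} (hu : Measurable u) (hv : Measurable v)
    (hw : Measurable w) (hui : Integrable (fun x => Real.exp (-u x)) μ)
    (hvi : Integrable (fun x => Real.exp (-v x)) μ)
    (hwi : Integrable (fun x => Real.exp (-w x)) μ)
    (h : ∀ x y, w (s • x + t • y) ≤ s * u x + t * v y) :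
    (∫ x, Real.exp (-u x) ∂μ) ^ s * (∫ x, Real.exp (-v x) ∂μ) ^ t ≤ ∫ x, Real.exp (-w x) ∂μ := by
  have hnonneg (g : E → ℝ) : 0 ≤ ∫ x, Real.exp (-g x) ∂μ :=
    integral_nonneg fun x => (Real.exp_pos _).le
  have hlint {g : E → ℝ} (hg : Integrable (fun x => Real.exp (-g x)) μ) :
      ∫⁻ x, ENNReal.ofReal (Real.exp (-g x)) ∂μ = ENNReal.ofReal (∫ x, Real.exp (-g x) ∂μ) :=
    (ofReal_integral_eq_lintegral_ofReal hg (.of_forall fun x => (Real.exp_pos _).le)).symm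
  have key := hμ hs ht hst (F := fun x => ENNReal.ofReal (Real.exp (-u x)))
    (G := fun x => ENNReal.ofReal (Real.exp (-v x)))
    (H := fun x => ENNReal.ofReal (Real.exp (-w x))) (by fun_prop) (by fun_prop) (by fun_prop)
    fun x y => by
      rw [ENNReal.ofReal_rpow_of_pos (Real.exp_pos _), ENNReal.ofReal_rpow_of_pos (Real.exp_pos _),
        ← ENNReal.ofReal_mul (by positivity), ← Real.exp_mul, ← Real.exp_mul, ← Real.exp_add]
      refine ENNReal.ofReal_le_ofReal (Real.exp_le_exp.2 ?_)
      linarith [h x y]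
  rwa [hlint hui, hlint hvi, hlint hwi, ENNReal.ofReal_rpow_of_nonneg (hnonneg u) hs.le,
    ENNReal.ofReal_rpow_of_nonneg (hnonneg v) ht.le,
    ← ENNReal.ofReal_mul (Real.rpow_nonneg (hnonneg u) s),
    ENNReal.ofReal_le_ofReal_iff (hnonneg w)] at key

end PrekopaLeindler

/-- The potential `f` with an added quadratic confinement of strength `t`; the paper's `f_i` is
the case `t = 1 / σ_i ^ 2`. -/
noncomputable def confinedPotential {E : Type*} [Norm E] (f : E → ℝ) (t : ℝ) (x : E) : ℝ :=
  f x + t / 2 * ‖x‖ ^ 2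

/-- The normalizing constant `Z` of the Gibbs density of the potential `u`. -/
noncomputable def partitionFunction {E : Type*} [MeasureSpace E] (u : E → ℝ) : ℝ :=
  ∫ x, Real.exp (-u x)

/-- The Gibbs density `Z⁻¹ exp (-u)` of the potential `u`; it is `0` if `exp (-u)` is not
integrable. -/
noncomputable def gibbsDensity {E : Type*} [MeasureSpace E] (u : E → ℝ) (x : E) : ℝ :=
  (partitionFunction u)⁻¹ * Real.exp (-u x)

theorem partitionFunction_le_partitionFunction {E : Type*} [MeasureSpace E] {u v : E → ℝ}
    (hu : Integrable fun x => Real.exp (-u x)) (huv : ∀ x, u x ≤ v x) :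
    partitionFunction v ≤ partitionFunction u :=
  integral_mono_of_nonneg (.of_forall fun _ => (Real.exp_pos _).le) hu
    (.of_forall fun x => by simpa using huv x)

theorem measurable_confinedPotential {E : Type*} [NormedAddCommGroup E] [MeasurableSpace E]
    [OpensMeasurableSpace E] {f : E → ℝ} (hf : Measurable f) (t : ℝ) :
    Measurable (confinedPotential f t) := by
  unfold confinedPotential
  fun_prop

theorem exp_neg_le_sqrt_mul_div_midpoint {a b : ℝ} (ha : 0 < a) (hb : 0 < b) :
    Real.exp (-((a - b) ^ 2 / (8 * (a * b)))) ≤ √(a * b) / ((a + b) / 2) := by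
  refine le_of_pow_le_pow_left₀ two_ne_zero (by positivity) ?_
  calc Real.exp (-((a - b) ^ 2 / (8 * (a * b)))) ^ 2
      = (Real.exp ((a - b) ^ 2 / (4 * (a * b))))⁻¹ := by
        rw [← Real.exp_nat_mul, ← Real.exp_neg]
        congr 1
        field_simp
        ring
    _ ≤ ((a - b) ^ 2 / (4 * (a * b)) + 1)⁻¹ := by
        gcongr
        exact Real.add_one_le_exp _
    _ = (√(a * b) / ((a + b) / 2)) ^ 2 := by
        rw [div_pow, Real.sq_sqrt (by positivity)]
        field_simp
        ring

theorem exp_neg_div_mul_div_le_div_add {c s δ : ℝ} (hc : 0 ≤ c) (hs : 0 < s) (hδ : 0 ≤ δ) :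
    Real.exp (-(δ / s)) * (c / s) ≤ c / (s + δ) := by
  calc Real.exp (-(δ / s)) * (c / s) ≤ (δ / s + 1)⁻¹ * (c / s) := by
        rw [Real.exp_neg]
        gcongr
        exact Real.add_one_le_exp _
    _ = c / (s + δ) := by
        field_simp
        ring

theorem sqrt_mul_div_half_add_sq_mul {a b : ℝ} (ha : 0 < a) (hb : 0 < b) :
    (√(a * b) / ((a + b) / 2)) ^ 2 * (a + b) ^ 2 = 4 * (a * b) := by
  rw [div_pow, Real.sq_sqrt (by positivity)]
  field_simp
  ring

theorem add_mul_norm_smul_midpoint_sq_le {E : Type*} [NormedAddCommGroup E]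
    [InnerProductSpace ℝ E] {a b : ℝ} (ha : 0 < a) (hb : 0 < b) (x y : E) :
    (a + b) * ‖(√(a * b) / ((a + b) / 2)) • ((1 / 2 : ℝ) • x + (1 / 2 : ℝ) • y)‖ ^ 2 ≤
      a * ‖x‖ ^ 2 + b * ‖y‖ ^ 2 := by
  set r := √(a * b) / ((a + b) / 2)
  have hr_sq : r ^ 2 * (a + b) ^ 2 = 4 * (a * b) := sqrt_mul_div_half_add_sq_mul ha hb
  -- After multiplying by `a + b`, the difference of the two sides is `‖a • x - b • y‖ ^ 2`.
  refine le_of_mul_le_mul_left ?_ (add_pos ha hb)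
  have hdiff : ‖a • x - b • y‖ ^ 2 =
      a ^ 2 * ‖x‖ ^ 2 - 2 * (a * b) * inner ℝ x y + b ^ 2 * ‖y‖ ^ 2 := by
    rw [norm_sub_sq_real, norm_smul, norm_smul, inner_smul_left, inner_smul_right, mul_pow,
      mul_pow, Real.norm_eq_abs, Real.norm_eq_abs, sq_abs, sq_abs, conj_trivial]
    ring
  have hmid : ‖r • ((1 / 2 : ℝ) • x + (1 / 2 : ℝ) • y)‖ ^ 2 =
      r ^ 2 / 4 * (‖x‖ ^ 2 + 2 * inner ℝ x y + ‖y‖ ^ 2) := by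
    rw [← smul_add, norm_smul, norm_smul, mul_pow, mul_pow, norm_add_sq_real,
      Real.norm_eq_abs, Real.norm_eq_abs, sq_abs, sq_abs]
    ring
  linear_combination (sq_nonneg ‖a • x - b • y‖) + hdiff + (a + b) ^ 2 * hmid +
    (‖x‖ ^ 2 + 2 * inner ℝ x y + ‖y‖ ^ 2) / 4 * hr_sq

theorem confinedPotential_smul_midpoint_le {E : Type*} [NormedAddCommGroup E]
    [InnerProductSpace ℝ E] {g : E → ℝ} (hg : ConvexOn ℝ Set.univ g) (hmin : ∀ x, g 0 ≤ g x)
    {a b : ℝ} (ha : 0 < a) (hb : 0 < b) (x y : E) :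
    confinedPotential g ((a + b) / 2)
        ((√(a * b) / ((a + b) / 2)) • ((1 / 2 : ℝ) • x + (1 / 2 : ℝ) • y)) ≤
      1 / 2 * confinedPotential g a x + 1 / 2 * confinedPotential g b y := by
  have hnorm := add_mul_norm_smul_midpoint_sq_le ha hb x y
  set r := √(a * b) / ((a + b) / 2) with hr
  have hr_nonneg : 0 ≤ r := by positivity
  have hr_le_one : r ≤ 1 := by
    rw [hr, div_le_one (by positivity), Real.sqrt_le_left (by positivity)]
    linarith [sq_nonneg (a - b)]
  set z := (1 / 2 : ℝ) • x + (1 / 2 : ℝ) • y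
  have hgz : g (r • z) ≤ 1 / 2 * g x + 1 / 2 * g y := by
    have hcontract := hg.2 (Set.mem_univ z) (Set.mem_univ 0) hr_nonneg (sub_nonneg.2 hr_le_one)
      (add_sub_cancel r 1)
    have hmid := hg.2 (Set.mem_univ x) (Set.mem_univ y) one_half_pos.le one_half_pos.le
      (add_halves 1)
    simp only [smul_zero, add_zero, smul_eq_mul] at hcontract hmid
    linarith [mul_nonneg (sub_nonneg.2 hr_le_one) (sub_nonneg.2 (hmin z))]
  unfold confinedPotential
  linarith

section PartitionFunction

open Module

variable {E : Type*} [NormedAddCommGroup E] [InnerProductSpace ℝ E] [FiniteDimensional ℝ E]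
  [MeasurableSpace E] [BorelSpace E] {f g : E → ℝ} {a b t : ℝ}

theorem partitionFunction_confinedPotential_const (C : ℝ) (ht : 0 < t) :
    partitionFunction (confinedPotential (fun _ : E => C) t) =
      Real.exp (-C) * (2 * Real.pi / t) ^ (finrank ℝ E / 2 : ℝ) := by
  have hsplit (x : E) : Real.exp (-confinedPotential (fun _ => C) t x) =
      Real.exp (-C) * Real.exp (-(t / 2) * ‖x‖ ^ 2) := by
    rw [confinedPotential, ← Real.exp_add]
    ring_nf
  simp only [partitionFunction, hsplit]
  rw [integral_const_mul, GaussianFourier.integral_rexp_neg_mul_sq_norm (half_pos ht),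
    div_div_eq_mul_div, mul_comm Real.pi]

theorem integrable_exp_neg_of_confinedPotential_const_le {u : E → ℝ} (hu : Measurable u) {C : ℝ}
    (ht : 0 < t) (h : ∀ x, confinedPotential (fun _ => C) t x ≤ u x) :
    Integrable fun x => Real.exp (-u x) := by
  have hgauss : Integrable fun x : E => Real.exp (-confinedPotential (fun _ => C) t x) := by
    refine .of_integral_ne_zero ?_
    change partitionFunction (confinedPotential (fun _ : E => C) t) ≠ 0
    rw [partitionFunction_confinedPotential_const C ht]
    positivity
  refine hgauss.mono' (by fun_prop) (.of_forall fun x => ?_)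
  rw [Real.norm_eq_abs, Real.abs_exp, Real.exp_le_exp]
  exact neg_le_neg (h x)

theorem integrable_exp_neg_confinedPotential (hf : Measurable f) (hmin : ∀ x, f 0 ≤ f x)
    (ht : 0 < t) : Integrable fun x => Real.exp (-confinedPotential f t x) :=
  integrable_exp_neg_of_confinedPotential_const_le (measurable_confinedPotential hf t) ht
    fun x => add_le_add_left (hmin x) _

/- Equivalently, `t ↦ t ^ finrank ℝ E * Z t` is midpoint log-concave for
`Z t = partitionFunction (confinedPotential g t)`. -/
theorem pow_mul_sqrt_partitionFunction_le (hg : ConvexOn ℝ Set.univ g) (hmin : ∀ x, g 0 ≤ g x)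
    (ha : 0 < a) (hb : 0 < b) :
    (√(a * b) / ((a + b) / 2)) ^ finrank ℝ E *
        √(partitionFunction (confinedPotential g a) * partitionFunction (confinedPotential g b)) ≤
      partitionFunction (confinedPotential g ((a + b) / 2)) := by
  have hm : 0 < (a + b) / 2 := by positivity
  have hr : 0 < √(a * b) / ((a + b) / 2) := by positivity
  set r := √(a * b) / ((a + b) / 2)
  have hgm : Measurable g := hg.locallyLipschitz.continuous.measurable
  have hint {t : ℝ} (ht : 0 < t) := integrable_exp_neg_confinedPotential hgm hmin ht
  have hmeas := measurable_confinedPotential hgm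
  have key := (prekopaLeindler_volume E).rpow_integral_exp_neg_mul_le one_half_pos one_half_pos
    (add_halves 1) (hmeas a) (hmeas b) ((hmeas _).comp (measurable_const_smul r)) (hint ha)
    (hint hb) ((hint hm).comp_smul hr.ne') (confinedPotential_smul_midpoint_le hg hmin ha hb)
  have hnonneg (t : ℝ) : 0 ≤ partitionFunction (confinedPotential g t) :=
    integral_nonneg fun x => (Real.exp_pos _).le
  calc r ^ finrank ℝ E *
        √(partitionFunction (confinedPotential g a) * partitionFunction (confinedPotential g b))
      ≤ r ^ finrank ℝ E * ∫ x, Real.exp (-confinedPotential g ((a + b) / 2) (r • x)) := by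
        rw [Real.sqrt_eq_rpow, Real.mul_rpow (hnonneg a) (hnonneg b)]
        exact mul_le_mul_of_nonneg_left key (by positivity)
    _ = partitionFunction (confinedPotential g ((a + b) / 2)) := by
        rw [Measure.integral_comp_smul_of_nonneg volume
          (fun x => Real.exp (-confinedPotential g ((a + b) / 2) x)) r (hR := hr.le), smul_eq_mul,
          mul_inv_cancel_left₀ (by positivity)]
        rfl

theorem exp_neg_mul_partitionFunction_confinedPotential_const_le (C : ℝ) (ht : 0 < t) {δ : ℝ}
    (hδ : 0 ≤ δ) :
    Real.exp (-(finrank ℝ E * δ / (2 * t))) *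
        partitionFunction (confinedPotential (fun _ : E => C) t) ≤
      partitionFunction (confinedPotential (fun _ : E => C) (t + δ)) := by
  have hpow := Real.rpow_le_rpow (z := finrank ℝ E / 2) (by positivity)
    (exp_neg_div_mul_div_le_div_add Real.two_pi_pos.le ht hδ) (by positivity)
  rw [Real.mul_rpow (by positivity) (by positivity), ← Real.exp_mul,
    show -(δ / t) * (finrank ℝ E / 2) = -(finrank ℝ E * δ / (2 * t)) by field_simp] at hpow
  rw [partitionFunction_confinedPotential_const C ht,
    partitionFunction_confinedPotential_const C (by positivity), mul_left_comm]
  gcongr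

theorem exp_neg_mul_sqrt_partitionFunction_zero_le (hf : Measurable f) (hmin : ∀ x, f 0 ≤ f x)
    {L : ℝ} (hL : 0 ≤ L) (hfL : ∀ x, f x ≤ f 0 + L / 2 * ‖x‖ ^ 2) (ht : 0 < t) :
    Real.exp (-(finrank ℝ E * L / (4 * t))) *
        √(partitionFunction (confinedPotential (fun _ : E => 0) t) *
          partitionFunction (confinedPotential f t)) ≤
      partitionFunction fun x =>
        (confinedPotential (fun _ => 0) t x + confinedPotential f t x) / 2 := by
  have hmf := measurable_confinedPotential hf t
  have hm0 := measurable_confinedPotential (f := fun _ : E => 0) measurable_const t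
  have hA (C : ℝ) := partitionFunction_confinedPotential_const (E := E) C ht
  set A := (2 * Real.pi / t) ^ (finrank ℝ E / 2 : ℝ)
  have hZ : partitionFunction (confinedPotential f t) ≤ Real.exp (-f 0) * A := by
    rw [← hA]
    exact partitionFunction_le_partitionFunction
      (integrable_exp_neg_confinedPotential measurable_const (fun _ => le_rfl) ht)
      fun x => add_le_add_left (hmin x) _
  have hsqrt : √(partitionFunction (confinedPotential (fun _ : E => 0) t) *
      partitionFunction (confinedPotential f t)) ≤
        partitionFunction (confinedPotential (fun _ : E => f 0 / 2) t) := by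
    rw [hA, hA, Real.sqrt_le_iff]
    refine ⟨by positivity, ?_⟩
    rw [neg_zero, Real.exp_zero, one_mul, mul_pow, ← Real.exp_nat_mul, Nat.cast_two, mul_neg,
      mul_div_cancel₀ _ two_ne_zero]
    linarith [mul_le_mul_of_nonneg_left hZ (by positivity : 0 ≤ A)]
  calc Real.exp (-(finrank ℝ E * L / (4 * t))) *
        √(partitionFunction (confinedPotential (fun _ : E => 0) t) *
          partitionFunction (confinedPotential f t))
      ≤ Real.exp (-(finrank ℝ E * (L / 2) / (2 * t))) *
          partitionFunction (confinedPotential (fun _ : E => f 0 / 2) t) := by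
        refine mul_le_mul (le_of_eq ?_) hsqrt (by positivity) (by positivity)
        congr 2
        field_simp
        norm_num
    _ ≤ partitionFunction (confinedPotential (fun _ : E => f 0 / 2) (t + L / 2)) :=
        exp_neg_mul_partitionFunction_confinedPotential_const_le _ ht (by positivity)
    _ ≤ partitionFunction fun x =>
          (confinedPotential (fun _ => 0) t x + confinedPotential f t x) / 2 := by
        refine partitionFunction_le_partitionFunction
          (integrable_exp_neg_of_confinedPotential_const_le (by fun_prop) (C := f 0 / 2) ht
            fun x => ?_) fun x => ?_ <;>
        simp only [confinedPotential]
        · linarith [hmin x]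
        · linarith [hfL x]

end PartitionFunction

theorem confinedPotential_sub_sq_norm_add {E : Type*} [Norm E] (f : E → ℝ) (m t : ℝ) :
    confinedPotential (fun x => f x - m / 2 * ‖x‖ ^ 2) (t + m) = confinedPotential f t := by
  ext x
  simp only [confinedPotential]
  ring

section StrongConvexity

variable {E : Type*} [NormedAddCommGroup E] [InnerProductSpace ℝ E] {f : E → ℝ} {m : ℝ}

theorem strongConvexOn_univ_of_forall_exists_inner_le
    (h : ∀ x, ∃ p : E, ∀ y, f x + inner ℝ p (y - x) + m / 2 * ‖y - x‖ ^ 2 ≤ f y) :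
    StrongConvexOn Set.univ m f := by
  refine ⟨convex_univ, fun x _ y _ a b ha hb hab => ?_⟩
  obtain ⟨p, hp⟩ := h (a • x + b • y)
  obtain rfl : b = 1 - a := by linarith
  have hx : x - (a • x + (1 - a) • y) = (1 - a) • (x - y) := by module
  have hy : y - (a • x + (1 - a) • y) = (-a) • (x - y) := by module
  have hpx := hp x
  have hpy := hp y
  rw [hx, inner_smul_right, norm_smul, mul_pow, Real.norm_eq_abs, sq_abs] at hpx
  rw [hy, inner_smul_right, norm_smul, mul_pow, Real.norm_eq_abs, sq_abs] at hpy
  simp only [smul_eq_mul]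
  linear_combination a * hpx + (1 - a) * hpy

theorem add_mul_sq_norm_sub_le_of_strongConvexOn (hf : StrongConvexOn Set.univ m f) {x₀ : E}
    (hmin : ∀ x, f x₀ ≤ f x) (x : E) : f x₀ + m / 2 * ‖x - x₀‖ ^ 2 ≤ f x := by
  have hchord : ∀ t ∈ Set.Ioo (0 : ℝ) 1, f x₀ + (1 - t) * (m / 2 * ‖x - x₀‖ ^ 2) ≤ f x := by
    intro t ht
    have hconv := hf.2 (Set.mem_univ x) (Set.mem_univ x₀) ht.1.le (sub_nonneg.2 ht.2.le)
      (add_sub_cancel t 1)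
    simp only [smul_eq_mul] at hconv
    refine le_of_mul_le_mul_left ?_ ht.1
    linarith [hmin (t • x + (1 - t) • x₀)]
  have hlim : Filter.Tendsto (fun t : ℝ => f x₀ + (1 - t) * (m / 2 * ‖x - x₀‖ ^ 2))
      (nhdsWithin 0 (Set.Ioi 0)) (nhds (f x₀ + m / 2 * ‖x - x₀‖ ^ 2)) := by
    refine tendsto_nhdsWithin_of_tendsto_nhds (Continuous.tendsto' (by fun_prop) _ _ (by simp))
  exact le_of_tendsto hlim (Filter.mem_of_superset (Ioo_mem_nhdsGT one_pos) hchord)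

end StrongConvexity

namespace IsSmoothStronglyConvex

variable {d : ℕ} {μ L : ℝ} {f : EuclideanSpace ℝ (Fin d) → ℝ}

theorem bregman_mem_Icc (hf : IsSmoothStronglyConvex μ L f) (x y : EuclideanSpace ℝ (Fin d)) :
    f y - f x - inner ℝ (gradient f x) (y - x) ∈
      Set.Icc (μ / 2 * ‖y - x‖ ^ 2) (L / 2 * ‖y - x‖ ^ 2) := by
  rcases eq_or_ne x y with rfl | hxy
  · simp
  have hpos : 0 < ‖x - y‖ ^ 2 / 2 := by
    have := norm_pos_iff.2 (sub_ne_zero.2 hxy)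
    positivity
  have hbounds := hf.2 x y hxy
  rw [Set.mem_Icc, le_div_iff₀ hpos, div_le_iff₀ hpos, norm_sub_rev x y] at hbounds
  constructor <;> linarith

theorem strongConvexOn (hf : IsSmoothStronglyConvex μ L f) : StrongConvexOn Set.univ μ f :=
  strongConvexOn_univ_of_forall_exists_inner_le fun x => ⟨gradient f x, fun y => by
    linarith [(hf.bregman_mem_Icc x y).1]⟩

theorem le_add_mul_sq_norm_sub (hf : IsSmoothStronglyConvex μ L f)
    {x₀ : EuclideanSpace ℝ (Fin d)} (hmin : ∀ x, f x₀ ≤ f x) (x : EuclideanSpace ℝ (Fin d)) :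
    f x ≤ f x₀ + L / 2 * ‖x - x₀‖ ^ 2 := by
  have hgrad : gradient f x₀ = 0 := by
    have hloc : IsLocalMin f x₀ := .of_forall hmin
    simp [gradient, hloc.fderiv_eq_zero]
  have hupper := (hf.bregman_mem_Icc x₀ x).2
  rw [hgrad, inner_zero_left] at hupper
  linarith

end IsSmoothStronglyConvex

section Overlap

variable {d : ℕ} {f u v : EuclideanSpace ℝ (Fin d) → ℝ} {μ a b : ℝ}

theorem memLp_sqrt_gibbsDensity (hu : Integrable fun x => Real.exp (-u x)) :
    MemLp (fun x => ((√(gibbsDensity u x) : ℝ) : ℂ)) 2 volume := by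
  have hint : Integrable (gibbsDensity u) := hu.const_mul _
  have hnonneg (x) : 0 ≤ gibbsDensity u x :=
    mul_nonneg (inv_nonneg.2 (integral_exp_pos hu).le) (Real.exp_pos _).le
  refine MemLp.ofReal ((memLp_two_iff_integrable_sq ?_).2 ?_)
  · exact hint.aemeasurable.sqrt.aestronglyMeasurable
  · exact hint.congr (.of_forall fun x => (Real.sq_sqrt (hnonneg x)).symm)

theorem norm_inner_qsample_gibbsDensity (hu : Integrable fun x => Real.exp (-u x))
    (hv : Integrable fun x => Real.exp (-v x)) :
    ‖inner ℂ (qsample (gibbsDensity u)) (qsample (gibbsDensity v))‖ =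
      partitionFunction (fun x => (u x + v x) / 2) /
        √(partitionFunction u * partitionFunction v) := by
  have hZu : 0 < partitionFunction u := integral_exp_pos hu
  have hZv : 0 < partitionFunction v := integral_exp_pos hv
  have hmu := memLp_sqrt_gibbsDensity hu
  have hmv := memLp_sqrt_gibbsDensity hv
  have hsqrt (x) : √(gibbsDensity u x) * √(gibbsDensity v x) =
      (√(partitionFunction u * partitionFunction v))⁻¹ * Real.exp (-((u x + v x) / 2)) := by
    rw [gibbsDensity, gibbsDensity, ← Real.sqrt_mul (by positivity), mul_mul_mul_comm, ← mul_inv,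
      ← Real.exp_add, Real.sqrt_mul (by positivity), Real.sqrt_inv, ← Real.exp_half]
    ring_nf
  have hinner : inner ℂ (qsample (gibbsDensity u)) (qsample (gibbsDensity v)) =
      (((√(partitionFunction u * partitionFunction v))⁻¹ *
        ∫ x, Real.exp (-((u x + v x) / 2)) : ℝ) : ℂ) := by
    rw [qsample, qsample, dif_pos hmu, dif_pos hmv, L2.inner_def,
      ← integral_const_mul, ← integral_complex_ofReal]
    refine integral_congr_ae ?_
    filter_upwards [hmu.coeFn_toLp, hmv.coeFn_toLp] with x hx hy
    rw [hx, hy, ← hsqrt]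
    simp [mul_comm]
  rw [hinner, Complex.norm_real, Real.norm_of_nonneg (by positivity), inv_mul_eq_div]
  rfl

theorem le_norm_inner_qsample_gibbsDensity (hu : Integrable fun x => Real.exp (-u x))
    (hv : Integrable fun x => Real.exp (-v x)) {q : ℝ}
    (h : q * √(partitionFunction u * partitionFunction v) ≤
      partitionFunction fun x => (u x + v x) / 2) :
    q ≤ ‖inner ℂ (qsample (gibbsDensity u)) (qsample (gibbsDensity v))‖ := by
  have hZu : 0 < partitionFunction u := integral_exp_pos hu
  have hZv : 0 < partitionFunction v := integral_exp_pos hv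
  rwa [norm_inner_qsample_gibbsDensity hu hv, le_div_iff₀ (by positivity)]

theorem exp_neg_le_norm_inner_qsample_confinedPotential (hf : StrongConvexOn Set.univ μ f)
    (hmin : ∀ x, f 0 ≤ f x) (ha : 0 < a + μ) (hb : 0 < b + μ) :
    Real.exp (-(d * (a - b) ^ 2 / (8 * ((a + μ) * (b + μ))))) ≤
      ‖inner ℂ (qsample (gibbsDensity (confinedPotential f a)))
        (qsample (gibbsDensity (confinedPotential f b)))‖ := by
  set g := fun x => f x - μ / 2 * ‖x‖ ^ 2 with hgdef
  have hg : ConvexOn ℝ Set.univ g := strongConvexOn_iff_convex.1 hf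
  have hgmin (x) : g 0 ≤ g x := by
    have hgrowth := add_mul_sq_norm_sub_le_of_strongConvexOn hf hmin x
    simp only [hgdef, norm_zero]
    rw [sub_zero] at hgrowth
    linarith
  have hgm : Measurable g := hg.locallyLipschitz.continuous.measurable
  have hmid : (fun x => (confinedPotential g (a + μ) x + confinedPotential g (b + μ) x) / 2) =
      confinedPotential g ((a + μ + (b + μ)) / 2) := by
    ext x
    simp only [confinedPotential]
    ring
  rw [← confinedPotential_sub_sq_norm_add f μ a, ← confinedPotential_sub_sq_norm_add f μ b]
  refine le_norm_inner_qsample_gibbsDensity (integrable_exp_neg_confinedPotential hgm hgmin ha)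
    (integrable_exp_neg_confinedPotential hgm hgmin hb) ?_
  rw [hmid]
  refine le_trans ?_ (pow_mul_sqrt_partitionFunction_le hg hgmin ha hb)
  rw [finrank_euclideanSpace_fin]
  gcongr
  calc Real.exp (-(d * (a - b) ^ 2 / (8 * ((a + μ) * (b + μ)))))
      = Real.exp (-((a + μ - (b + μ)) ^ 2 / (8 * ((a + μ) * (b + μ))))) ^ d := by
        rw [← Real.exp_nat_mul]
        ring_nf
    _ ≤ (√((a + μ) * (b + μ)) / ((a + μ + (b + μ)) / 2)) ^ d := by
        gcongr
        exact exp_neg_le_sqrt_mul_div_midpoint ha hb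

theorem exp_neg_sq_div_le_norm_inner_qsample_confinedPotential
    (hf : StrongConvexOn Set.univ μ f) (hmin : ∀ x, f 0 ≤ f x) (hb : 0 < b + μ) (hab : b ≤ a)
    {k : ℝ} (hk : √d * (a - b) ≤ k * (b + μ)) :
    Real.exp (-(k ^ 2 / 8)) ≤
      ‖inner ℂ (qsample (gibbsDensity (confinedPotential f a)))
        (qsample (gibbsDensity (confinedPotential f b)))‖ := by
  have ha : 0 < a + μ := by linarith
  refine le_trans ?_ (exp_neg_le_norm_inner_qsample_confinedPotential hf hmin ha hb)
  have hsq : d * (a - b) ^ 2 ≤ k ^ 2 * ((a + μ) * (b + μ)) := by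
    calc d * (a - b) ^ 2 = (√d * (a - b)) ^ 2 := by rw [mul_pow, Real.sq_sqrt d.cast_nonneg]
      _ ≤ (k * (b + μ)) ^ 2 := by
        have := sub_nonneg.2 hab
        gcongr
      _ = k ^ 2 * ((b + μ) * (b + μ)) := by ring
      _ ≤ k ^ 2 * ((a + μ) * (b + μ)) := by gcongr
  rw [Real.exp_le_exp, neg_le_neg_iff, div_le_div_iff₀ (by positivity) (by positivity)]
  linarith

theorem exp_neg_le_norm_inner_qsample_gaussian {L t : ℝ} (hf : Measurable f)
    (hmin : ∀ x, f 0 ≤ f x) (hL : 0 ≤ L) (hfL : ∀ x, f x ≤ f 0 + L / 2 * ‖x‖ ^ 2) (ht : 0 < t) :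
    Real.exp (-(d * L / (4 * t))) ≤
      ‖inner ℂ (qsample (gibbsDensity (confinedPotential (fun _ => 0) t)))
        (qsample (gibbsDensity (confinedPotential f t)))‖ := by
  refine le_norm_inner_qsample_gibbsDensity
    (integrable_exp_neg_confinedPotential measurable_const (fun _ => le_rfl) ht)
    (integrable_exp_neg_confinedPotential hf hmin ht) ?_
  simpa only [finrank_euclideanSpace_fin] using
    exp_neg_mul_sqrt_partitionFunction_zero_le hf hmin hL hfL ht

end Overlap

section Annealing

variable {d M i : ℕ} {f : EuclideanSpace ℝ (Fin d) → ℝ} {σ : ℕ → ℝ}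

theorem annealDensity_eq_gibbsDensity (hi : i ≠ 0) :
    annealDensity f σ M i = gibbsDensity (annealPotential f σ M i) := by
  ext x
  rw [annealDensity, if_neg hi, gibbsDensity, partitionFunction]

theorem annealDensity_zero (hσ : σ 1 ≠ 0) :
    annealDensity f σ M 0 = gibbsDensity (confinedPotential (fun _ => 0) (1 / σ 1 ^ 2)) := by
  ext x
  rw [annealDensity, if_pos rfl, gibbsDensity,
    partitionFunction_confinedPotential_const 0 (by positivity), finrank_euclideanSpace_fin,
    neg_zero, Real.exp_zero, one_mul, one_div, div_inv_eq_mul, neg_div,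
    Real.rpow_neg (by positivity)]
  congr 2
  simp only [annealPotential, if_true, confinedPotential]
  ring

theorem annealDensity_of_le (hi : i ≠ 0) (hiM : i ≤ M) :
    annealDensity f σ M i = gibbsDensity (confinedPotential f (1 / σ i ^ 2)) := by
  rw [annealDensity_eq_gibbsDensity hi]
  congr 1
  ext x
  rw [annealPotential, if_neg hi, if_pos hiM, confinedPotential]
  ring

theorem annealDensity_add_one_self :
    annealDensity f σ M (M + 1) = gibbsDensity (confinedPotential f 0) := by
  rw [annealDensity_eq_gibbsDensity M.succ_ne_zero]
  congr 1
  ext x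
  simp [annealPotential, confinedPotential]

end Annealing

/-- A schedule of widths `σ 1, …, σ M` for annealing from a narrow Gaussian to `exp (-f)`, where
`f` has strong convexity parameter `μ` and smoothness parameter `L`. The conditions are written
without division; the paper's geometric schedule satisfies them by
`IsAnnealingSchedule.of_geometric`. -/
structure IsAnnealingSchedule (c : ℝ) (d : ℕ) (μ L : ℝ) (M : ℕ) (σ : ℕ → ℝ) : Prop where
  one_le : 1 ≤ M
  ne_zero : σ 1 ≠ 0
  mul_sq_one_le : 2 * d * L * σ 1 ^ 2 ≤ 1
  sq_le_sq_succ (i : ℕ) : 1 ≤ i → i < M → σ i ^ 2 ≤ σ (i + 1) ^ 2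
  sqrt_mul_sub_le (i : ℕ) : 1 ≤ i → i < M → √d * (σ (i + 1) ^ 2 - σ i ^ 2) ≤ σ i ^ 2
  le_mul_sq_last : c * √d ≤ μ * σ M ^ 2

namespace IsAnnealingSchedule

variable {c : ℝ} {d : ℕ} {μ L : ℝ} {M i : ℕ} {σ : ℕ → ℝ}

theorem of_geometric (hd : 1 ≤ d) (hμ : 0 < μ) (hL : 0 < L) {ε : ℝ} (hε : 0 < ε) (hε1 : ε ≤ 1)
    (hM : 1 ≤ M) (hfirst : σ 1 ^ 2 = ε / (2 * d * L))
    (hstep : ∀ i, 1 ≤ i → i < M → σ (i + 1) ^ 2 = (1 + 1 / √d) * σ i ^ 2)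
    (hlast : c * (√d / μ) ≤ σ M ^ 2) : IsAnnealingSchedule c d μ L M σ where
  one_le := hM
  ne_zero := by
    rw [← sq_pos_iff, hfirst]
    positivity
  mul_sq_one_le := by rwa [hfirst, mul_div_cancel₀ _ (by positivity)]
  sq_le_sq_succ i hi hiM := by
    rw [hstep i hi hiM]
    exact le_mul_of_one_le_left (sq_nonneg _) (le_add_of_nonneg_right (by positivity))
  sqrt_mul_sub_le i hi hiM := by
    have : √(d : ℝ) ≠ 0 := by positivity
    refine le_of_eq ?_
    rw [hstep i hi hiM]
    field_simp
    ring
  le_mul_sq_last := by rwa [← mul_div_assoc, div_le_iff₀' hμ] at hlast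

theorem sq_pos (hσ : IsAnnealingSchedule c d μ L M σ) (hi : 1 ≤ i) : i ≤ M → 0 < σ i ^ 2 := by
  induction i, hi using Nat.le_induction with
  | base => exact fun _ => sq_pos_of_ne_zero hσ.ne_zero
  | succ j hj ih => exact fun hjM => (ih (by lia)).trans_le (hσ.sq_le_sq_succ j hj hjM)

theorem sqrt_mul_one_div_sub_one_div_le (hσ : IsAnnealingSchedule c d μ L M σ) (hi : 1 ≤ i)
    (hiM : i < M) : √d * (1 / σ i ^ 2 - 1 / σ (i + 1) ^ 2) ≤ 1 / σ (i + 1) ^ 2 := by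
  have hσi := hσ.sq_pos hi hiM.le
  have hσi' := hσ.sq_pos (i := i + 1) (by lia) hiM
  rw [div_sub_div _ _ hσi.ne' hσi'.ne', one_mul, mul_one, mul_div_assoc',
    div_le_div_iff₀ (by positivity) hσi', one_mul]
  exact mul_le_mul_of_nonneg_right (hσ.sqrt_mul_sub_le i hi hiM) hσi'.le

theorem sqrt_mul_one_div_last_le (hσ : IsAnnealingSchedule c d μ L M σ) (hc : 0 < c) :
    √d * (1 / σ M ^ 2) ≤ 1 / c * μ := by
  rw [mul_one_div, one_div_mul_eq_div, div_le_div_iff₀ (hσ.sq_pos hσ.one_le le_rfl) hc]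
  linarith [hσ.le_mul_sq_last]

end IsAnnealingSchedule

theorem mainTheorem10_general {c : ℝ} (hc : 0 < c) {d : ℕ} {μ L : ℝ} (hμ : 0 < μ) (hL : 0 ≤ L)
    {f : EuclideanSpace ℝ (Fin d) → ℝ} (hf : StrongConvexOn Set.univ μ f)
    (hmin : ∀ x, f 0 ≤ f x) (hfL : ∀ x, f x ≤ f 0 + L / 2 * ‖x‖ ^ 2) {M : ℕ} {σ : ℕ → ℝ}
    (hσ : IsAnnealingSchedule c d μ L M σ) {i : ℕ} (hi : i ≤ M) :
    Real.exp (-(max 1 (1 / c) ^ 2 / 8)) ≤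
      ‖inner ℂ (qsample (annealDensity f σ M i)) (qsample (annealDensity f σ M (i + 1)))‖ := by
  have hk1 : 1 ≤ max 1 (1 / c) := le_max_left _ _
  have hkc : 1 / c ≤ max 1 (1 / c) := le_max_right _ _
  rcases Nat.eq_zero_or_pos i with rfl | hi0
  · have hσ1 := hσ.sq_pos le_rfl hσ.one_le
    have hfm : Measurable f :=
      (strongConvexOn_zero.1 (hf.mono hμ.le)).locallyLipschitz.continuous.measurable
    rw [annealDensity_zero hσ.ne_zero, zero_add, annealDensity_of_le one_ne_zero hσ.one_le]
    refine le_trans ?_ (exp_neg_le_norm_inner_qsample_gaussian hfm hmin hL hfL (by positivity))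
    rw [Real.exp_le_exp, neg_le_neg_iff, mul_one_div, div_div_eq_mul_div]
    linarith [one_le_pow₀ hk1 (n := 2), hσ.mul_sq_one_le]
  have hσi := hσ.sq_pos hi0 hi
  rcases hi.eq_or_lt with rfl | hiM
  · rw [annealDensity_of_le hi0.ne' le_rfl, annealDensity_add_one_self]
    refine exp_neg_sq_div_le_norm_inner_qsample_confinedPotential hf hmin (by linarith)
      (by positivity) ?_
    rw [sub_zero, zero_add]
    exact (hσ.sqrt_mul_one_div_last_le hc).trans (by gcongr)
  · have hσi' := hσ.sq_pos i.succ_pos hiM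
    rw [annealDensity_of_le hi0.ne' hi, annealDensity_of_le i.succ_ne_zero hiM]
    refine exp_neg_sq_div_le_norm_inner_qsample_confinedPotential hf hmin (by positivity)
      (one_div_le_one_div_of_le hσi (hσ.sq_le_sq_succ i hi0 hiM)) ?_
    calc √d * (1 / σ i ^ 2 - 1 / σ (i + 1) ^ 2)
        ≤ 1 / σ (i + 1) ^ 2 + μ := by linarith [hσ.sqrt_mul_one_div_sub_one_div_le hi0 hiM]
      _ ≤ max 1 (1 / c) * (1 / σ (i + 1) ^ 2 + μ) := le_mul_of_one_le_left (by positivity) hk1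

theorem mainTheorem10 (c : ℝ) (hc : 0 < c) :
    ∃ p : ℝ, 0 < p ∧
      ∀ (d : ℕ) (_ : 1 ≤ d) (μ L ε : ℝ) (_ : 0 < μ) (_ : 0 < L) (_ : 0 < ε) (_ : ε < 1)
        (f : EuclideanSpace ℝ (Fin d) → ℝ) (_ : IsSmoothStronglyConvex μ L f)
        (_ : ∀ x, f 0 ≤ f x)
        (M : ℕ) (_ : 1 ≤ M) (σ : ℕ → ℝ)
        (_ : σ 1 ^ 2 = ε / (2 * d * L))
        (_ : ∀ i, 1 ≤ i → i < M → σ (i + 1) ^ 2 = (1 + 1 / Real.sqrt d) * σ i ^ 2)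
        (_ : c * (Real.sqrt d / μ) ≤ σ M ^ 2),
        ∀ i, i ≤ M →
          p ≤ ‖inner ℂ (qsample (annealDensity f σ M i))
                (qsample (annealDensity f σ M (i + 1)))‖ :=
  ⟨_, Real.exp_pos _, fun _ hd _ _ _ hμ hL hε hε1 _ hf hmin _ hM _ hfirst hstep hlast _ hi =>
    mainTheorem10_general hc hμ hL.le hf.strongConvexOn hmin
      (by simpa using hf.le_add_mul_sq_norm_sub hmin)
      (.of_geometric hd hμ hL hε hε1.le hM hfirst hstep hlast) hi⟩
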